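/- **Setting.** A finite *ordered Family Tree* is a finite directed tree, with edges going from child to parent, in which every vertex has at most one parent and the children of every vertex are totally ordered. A rooted Family Tree $[T,o]$ is such a tree with a distinguished vertex $o$ (which may have a parent), considered up to isomorphisms preserving the root, the orientation and the order; doubly rooted trees $[T,u,v]$ are defined similarly. Let $D(o)$ be the set consisting of $o$ and all its descendants, let $d_1(o)$ be the number of children of $o$, and let the *non-descendant tree* of $o$ be the subtree induced by $(V(T)\setminus D(o))\cup\{o\}$, rooted at $o$. A random finite rooted Family Tree $[\mathbf T,\mathbf o]$ is *unimodular* if $$\mathbb E\Big[\sum_{u\in V(\mathbf T)} f([\mathbf T,\mathbf o,u])\Big]=\mathbb E\Big[\sum_{u\in V(\mathbf T)} f([\mathbf T,u,\mathbf o])\Big]$$ for every non-negative measurable function $f$ of doubly rooted trees. Let $\pi$ be a probability distribution on $\{0,1,2,\dots\}$ with mean $m(\pi)<1$. The *Typically rooted Galton–Watson Tree* $TGWT(\pi)$ is the following random rooted ordered Family Tree. The number of ancestors of the root $\mathbf o$ equals $n$ with probability $m(\pi)^n(1-m(\pi))$, $n\ge 0$. Each ancestor of $\mathbf o$ has $k$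 children with probability $\hat\pi(k)=k\pi(k)/m(\pi)$, and its child which is $\mathbf o$ or an ancestor of $\mathbf o$ takes a uniformly distributed position among these $k$ children. Ordered Galton–Watson trees with offspring distribution $\pi$ are attached to the other children of the ancestors and to $\mathbf o$. All these choices are independent (apart from the dependence of the position on $k$). For $m(\pi)=0$ this is the tree with one vertex. **Proposition (Characterization of TGWT).** Let $[\mathbf T,\mathbf o]$ be a random finite rooted ordered Family Tree. Then $[\mathbf T,\mathbf o]$ is distributed as $TGWT(\pi)$ for some probability distribution $\pi$ on $\{0,1,2,\dots\}$ with $m(\pi)<1$ if and only if 1. $[\mathbf T,\mathbf o]$ is unimodular, and 2. the number of children $d_1(\mathbf o)$ of the root is independent of the non-descendant tree of the root. -/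

import Mathlib

open MeasureTheory ProbabilityTheory
open scoped ENNReal NNReal

namespace FamilyTrees

noncomputable section

/-!
## Finite ordered Family Trees

A finite ordered Family Tree is a finite directed tree, with edges going from child to parent, in
which every vertex has at most one parent and the children of every vertex are totally ordered.
Such a tree has exactly one vertex without a parent (its top vertex), and, having no automorphism
that preserves the order, its isomorphism class is the same thing as its Ulam-Harris-Neveu code:
the top vertex is the empty word, and the `i`-th child (`i = 0, 1, 2, …`) of the vertex `w` is the
word `i :: w`.  So the parent of `i :: w` is `w`, and the ancestors of a word are its suffixes.
-/

/-- Finite ordered Family Trees up to isomorphism: finite sets of words that contain the top vertex,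
the parent of each of their vertices, and every smaller sibling of each of their vertices. -/
@[ext]
structure FinFamilyTree where
  verts : Finset (List ℕ)
  top_mem : [] ∈ verts
  parent_mem : ∀ (i : ℕ) (w : List ℕ), i :: w ∈ verts → w ∈ verts
  sibling_mem : ∀ (i j : ℕ) (w : List ℕ), i :: w ∈ verts → j < i → j :: w ∈ verts

/-- The vertex set of a finite ordered Family Tree, as a type. -/
abbrev FinFamilyTree.Vertex (T : FinFamilyTree) : Type := {w : List ℕ // w ∈ T.verts}

/-- Rooted finite ordered Family Trees `[T, o]` up to rooted isomorphism.  The root `o` is an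
arbitrary vertex of `T`; it need not be the top vertex. -/
@[ext]
structure RootedFamilyTree where
  tree : FinFamilyTree
  root : tree.Vertex

/-- Doubly rooted finite ordered Family Trees `[T, u, v]` up to doubly rooted isomorphism. -/
structure DoublyRootedFamilyTree where
  tree : FinFamilyTree
  fst : tree.Vertex
  snd : tree.Vertex

/-- A finite tree is an isolated point for the local topology, so the Borel `σ`-algebra of the local
topology is the discrete one on (the countable set of) finite rooted Family Trees. -/
instance : MeasurableSpace RootedFamilyTree := ⊤

/-- The number `d₁(o)` of children of the root. -/
def RootedFamilyTree.numChildren (x : RootedFamilyTree) : ℕ :=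
  open Classical in (x.tree.verts.filter fun v => ∃ i : ℕ, v = i :: x.root.1).card

/-- The non-descendant tree `[D^c(o), o]` of the root `o`: the subtree induced by the vertices that
are not descendants of `o`, together with `o` itself, rooted at `o`.  (A vertex `v` is a descendant
of `o`, or equal to `o`, if and only if the word `o` is a suffix of the word `v`.) -/
def RootedFamilyTree.nonDescendantTree (x : RootedFamilyTree) : RootedFamilyTree where
  tree :=
    { verts := x.tree.verts.filter fun v => v = x.root.1 ∨ ¬ x.root.1 <:+ v
      top_mem := by
        refine Finset.mem_filter.2 ⟨x.tree.top_mem, ?_⟩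
        by_cases h : x.root.1 <:+ []
        · exact Or.inl (List.suffix_nil.1 h).symm
        · exact Or.inr h
      parent_mem := by
        intro i w h
        obtain ⟨h1, h2⟩ := Finset.mem_filter.1 h
        refine Finset.mem_filter.2 ⟨x.tree.parent_mem i w h1, Or.inr fun h3 => ?_⟩
        rcases h2 with h2 | h2
        · have := h3.length_le
          rw [← h2] at this
          simp at this
        · exact h2 (h3.trans (List.suffix_cons i w))
      sibling_mem := by
        intro i j w h hj
        obtain ⟨h1, h2⟩ := Finset.mem_filter.1 h
        refine Finset.mem_filter.2 ⟨x.tree.sibling_mem i j w h1 hj, ?_⟩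
        by_cases h3 : x.root.1 <:+ j :: w
        · rcases List.suffix_cons_iff.1 h3 with h4 | h4
          · exact Or.inl h4.symm
          · exfalso
            rcases h2 with h2 | h2
            · have := h4.length_le
              rw [← h2] at this
              simp at this
            · exact h2 (h4.trans (List.suffix_cons i w))
        · exact Or.inr h3 }
  root := ⟨x.root.1, Finset.mem_filter.2 ⟨x.root.2, Or.inl rfl⟩⟩

/-- Unimodularity of a random finite rooted Family Tree `X = [𝐓, 𝐨]`: the Mass Transport Principle
`𝔼[∑ᵤ f([𝐓, 𝐨, u])] = 𝔼[∑ᵤ f([𝐓, u, 𝐨])]` for every non-negative function `f` on doubly rooted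
finite Family Trees (all such functions are measurable, the local topology being discrete there). -/
def IsUnimodular {Ω : Type*} [MeasurableSpace Ω] (P : Measure Ω) (X : Ω → RootedFamilyTree) :
    Prop :=
  ∀ f : DoublyRootedFamilyTree → ℝ≥0,
    ∫⁻ ω, ∑ u : (X ω).tree.Vertex, (f ⟨(X ω).tree, (X ω).root, u⟩ : ℝ≥0∞) ∂P =
      ∫⁻ ω, ∑ u : (X ω).tree.Vertex, (f ⟨(X ω).tree, u, (X ω).root⟩ : ℝ≥0∞) ∂P

/-!
## Typically rooted Galton-Watson Trees
-/

/-- The mean `m(π)` of a probability distribution on `{0, 1, 2, …}`, possibly infinite. -/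
def mean (π : PMF ℕ) : ℝ≥0∞ := ∑' k : ℕ, (k : ℝ≥0∞) * π k

/-- The size-biased distribution `k ↦ k π(k) / m(π)`, for `0 < m(π) < ∞`.  (Otherwise there is no
such distribution, and the value chosen here is irrelevant.) -/
def sizeBiased (π : PMF ℕ) : PMF ℕ :=
  open Classical in
  if h : mean π ≠ 0 ∧ mean π ≠ ∞ then PMF.normalize (fun k : ℕ => (k : ℝ≥0∞) * π k) h.1 h.2
  else PMF.pure 1

/-- The uniform distribution on `{0, …, k - 1}`, for `0 < k`. -/
def uniformPosition (k : ℕ) : PMF ℕ :=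
  if h : 0 < k then PMF.uniformOfFinset (Finset.range k) (Finset.nonempty_range_iff.2 h.ne')
  else PMF.pure 0

/-- The joint law of `(Z, U)`, where `Z` has the size-biased distribution of `π` and, given `Z`, the
position `U` is uniform on `{0, …, Z - 1}`: an ancestor of the root has `Z` children, of which
`Z - 1` are new ones, and the child that was already there takes position `U` among them. -/
def ancestorLaw (π : PMF ℕ) : PMF (ℕ × ℕ) :=
  (sizeBiased π).bind fun k => (uniformPosition k).map fun u => (k, u)

/-- The random data from which the Typically rooted Galton-Watson Tree is built: the number `N` of
ancestors of the root, for each `j = 0, 1, …` the pair `(Z, U)` of the ancestor of order `j + 1`,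
and for each word the number of children of that vertex, if it is not an ancestor of the root. -/
abbrev Seed : Type := ℕ × (ℕ → ℕ × ℕ) × (List ℕ → ℕ)

/-- All the random data are independent; the number of ancestors is geometric with success
probability `1 - m(π)`, i.e. equal to `n` with probability `m(π) ^ n * (1 - m(π))`; the pairs of the
ancestors have the law above; the other numbers of children have the law `π`. -/
def seedLaw (π : PMF ℕ) (hπ : mean π < 1) : Measure Seed :=
  (geometricMeasure ⟨1 - (mean π).toReal,
      sub_nonneg.2 (ENNReal.toReal_le_of_le_ofReal zero_le_one (by simpa using hπ.le)),
      sub_le_self 1 ENNReal.toReal_nonneg⟩).prod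
    ((Measure.infinitePi fun _ : ℕ => (ancestorLaw π).toMeasure).prod
      (Measure.infinitePi fun _ : List ℕ => π.toMeasure))

/-- The root `o` is the word `U₀ :: U₁ :: … :: U_{N-1} :: []`: it has `N` ancestors, and the ancestor
of order `j` is the child in position `U_j` of the ancestor of order `j + 1`. -/
def seedRoot (s : Seed) : List ℕ := (List.range s.1).map fun j => (s.2.1 j).2

/-- The number of children of the vertex `w`.  If `w` is the ancestor of the root of order `j + 1`,
i.e. a suffix of the root of length `N - (j + 1)`, it is given by the pair with index `j`. -/
def seedChildren (s : Seed) (w : List ℕ) : ℕ :=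
  if w <:+ seedRoot s ∧ w ≠ seedRoot s then (s.2.1 (s.1 - w.length - 1)).1 else s.2.2 w

/-- The vertex set (possibly infinite) of the ordered tree whose vertices `w` have `c w` children. -/
def treeOf (c : List ℕ → ℕ) : Set (List ℕ) :=
  {v | ∀ (i : ℕ) (w : List ℕ), i :: w <:+ v → i < c w}

/-- The discrete `σ`-algebra on the countable set of words. -/
instance : MeasurableSpace (List ℕ) := ⊤

/-- The Typically rooted Galton-Watson Tree built from the data: its vertex set and its root. -/
def seedTree (s : Seed) : Set (List ℕ) × List ℕ := (treeOf (seedChildren s), seedRoot s)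

/-- The tree is a measurable function of the data, so that its law below is a genuine image law. -/
theorem measurable_seedTree : Measurable seedTree := by
  refine measurable_from_prod_countable_right fun n => ?_
  have hZU : ∀ j : ℕ, Measurable fun y : (ℕ → ℕ × ℕ) × (List ℕ → ℕ) => y.1 j := fun j =>
    (measurable_pi_apply j).comp measurable_fst
  have hroot : Measurable fun y : (ℕ → ℕ × ℕ) × (List ℕ → ℕ) => seedRoot (n, y) := by
    unfold seedRoot
    induction n with
    | zero => exact measurable_const
    | succ n ih =>
      have h : Measurable fun p : List ℕ × ℕ => p.1 ++ [p.2] := measurable_of_countable _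
      have h1 := h.comp (ih.prodMk (measurable_snd.comp (hZU n)))
      simpa [Function.comp_def, List.range_succ] using h1
  have hchildren : ∀ w : List ℕ,
      Measurable fun y : (ℕ → ℕ × ℕ) × (List ℕ → ℕ) => seedChildren (n, y) w := fun w =>
    Measurable.ite (hroot (t := {o | w <:+ o ∧ w ≠ o}) trivial)
      (measurable_fst.comp (hZU (n - w.length - 1))) ((measurable_pi_apply w).comp measurable_snd)
  refine Measurable.prodMk (measurable_set_iff.2 fun v => ?_) hroot
  refine Measurable.forall fun i => Measurable.forall fun w => ?_
  refine Measurable.imp measurable_const ?_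
  exact (measurable_of_countable fun c : ℕ => i < c).comp (hchildren w)

instance (π : PMF ℕ) (hπ : mean π < 1) : IsProbabilityMeasure (seedLaw π hπ) := by
  unfold seedLaw
  infer_instance

/-- The law of the Typically rooted Galton-Watson Tree with offspring distribution `π`, on pairs
formed by a set of words (with the product `σ`-algebra) and a word.  For `m(π) = 0`, that is
`π = δ₀`, it is the law of the tree with a single vertex. -/
def TGWT (π : PMF ℕ) (hπ : mean π < 1) : Measure (Set (List ℕ) × List ℕ) :=
  (seedLaw π hπ).map seedTree

instance (π : PMF ℕ) (hπ : mean π < 1) : IsProbabilityMeasure (TGWT π hπ) :=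
  Measure.isProbabilityMeasure_map measurable_seedTree.aemeasurable

/-- A random finite rooted Family Tree is a Typically rooted Galton-Watson Tree if its law is that of
`TGWT(π)` for some probability distribution `π` on `{0, 1, 2, …}` with mean `m(π) < 1`. -/
def IsTGWT {Ω : Type*} [MeasurableSpace Ω] (P : Measure Ω) (X : Ω → RootedFamilyTree) : Prop :=
  ∃ (π : PMF ℕ) (hπ : mean π < 1),
    P.map (fun ω => ((↑(X ω).tree.verts : Set (List ℕ)), (X ω).root.1)) = TGWT π hπ

end

end FamilyTrees

namespace FamilyTrees

/-! ### Trees and their codes -/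

/-! The key is the mass function (`TGWT_singleton`): under `TGWT π`, a finite rooted tree has mass
`(1 - m(π)) ∏ π(d(v))` over all its vertices `v`. An ancestor with `k` children contributes a factor
`m(π)` from the geometric law, `k π(k) / m(π)` from size-biasing and `1 / k` from the position,
hence `π(k)`, like every other vertex. The root drops out, which gives unimodularity; the product
splits along the root into descendants and non-descendants, which gives independence.

Conversely, let `π` be the law of `d₁(o)`. Mass transport from parents to children gives `P(o is the
top vertex) = 1 - m(π)`, and transport between two fixed vertices shows that the root may be moved
without changing probabilities. In `measure_agreeOn` the product is built one vertex at a time: move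
the root from the top to a deepest prescribed vertex `v`, split off `π(d(v))` by independence, and
move the root back. Codes of finite trees are countable, so equal mass functions give equal laws
(`map_code_eq_TGWT_iff`). -/

/-- The number of children of the vertex `w` of `T`. -/
noncomputable def FinFamilyTree.deg (T : FinFamilyTree) (w : List ℕ) : ℕ :=
  open Classical in (T.verts.filter fun v => ∃ i : ℕ, v = i :: w).card

/-- Closure under smaller siblings makes the child positions an initial segment of `ℕ`, ending at
the first missing one. -/
theorem FinFamilyTree.cons_mem_iff (T : FinFamilyTree) (i : ℕ) (w : List ℕ) :
    i :: w ∈ T.verts ↔ i < T.deg w := by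
  classical
  have hinj : Function.Injective fun i : ℕ => i :: w := fun a b h => (List.cons.inj h).1
  have hex : ∃ n : ℕ, n :: w ∉ T.verts :=
    Infinite.exists_notMem_finset (T.verts.preimage _ hinj.injOn) |>.imp fun n hn => by
      simpa using hn
  have key : ∀ j, j :: w ∈ T.verts ↔ j < Nat.find hex := fun j => by
    refine ⟨fun h => lt_of_not_ge fun hle => Nat.find_spec hex ?_, fun h => ?_⟩
    · rcases hle.lt_or_eq with h1 | h1
      · exact T.sibling_mem _ _ _ h h1
      · rwa [h1]
    · exact not_not.1 (Nat.find_min hex h)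
  have hfil : (T.verts.filter fun v => ∃ i : ℕ, v = i :: w) =
      (Finset.range (Nat.find hex)).image fun i => i :: w := by
    ext v
    simp only [Finset.mem_filter, Finset.mem_image, Finset.mem_range]
    constructor
    · rintro ⟨hv, i, rfl⟩
      exact ⟨i, (key i).1 hv, rfl⟩
    · rintro ⟨i, hi, rfl⟩
      exact ⟨(key i).2 hi, i, rfl⟩
  rw [key, FinFamilyTree.deg, hfil, Finset.card_image_of_injective _ hinj, Finset.card_range]

theorem RootedFamilyTree.numChildren_eq (x : RootedFamilyTree) :
    x.numChildren = x.tree.deg x.root.1 := rfl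

theorem FinFamilyTree.mem_of_suffix (T : FinFamilyTree) {w v : List ℕ} (h : w <:+ v)
    (hv : v ∈ T.verts) : w ∈ T.verts := by
  induction v with
  | nil => rwa [List.suffix_nil.1 h]
  | cons i v ih =>
    rcases List.suffix_cons_iff.1 h with rfl | h
    · exact hv
    · exact ih h (T.parent_mem i v hv)

theorem FinFamilyTree.verts_injective : Function.Injective FinFamilyTree.verts :=
  fun _ _ h => FinFamilyTree.ext h

instance : Countable FinFamilyTree := FinFamilyTree.verts_injective.countable

/-- A rooted tree is a tree with one of its vertices. -/
def rootedEquiv : RootedFamilyTree ≃ Σ T : FinFamilyTree, T.Vertex where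
  toFun x := ⟨x.tree, x.root⟩
  invFun y := ⟨y.1, y.2⟩
  left_inv _ := rfl
  right_inv _ := rfl

instance : Countable RootedFamilyTree := rootedEquiv.injective.countable

instance : DiscreteMeasurableSpace RootedFamilyTree := ⟨fun _ => trivial⟩

instance : DiscreteMeasurableSpace (List ℕ) := ⟨fun _ => trivial⟩

/-- The code of a rooted tree. -/
def RootedFamilyTree.code (x : RootedFamilyTree) : Set (List ℕ) × List ℕ :=
  (↑x.tree.verts, x.root.1)

theorem RootedFamilyTree.code_injective : Function.Injective RootedFamilyTree.code := by
  rintro ⟨T, o⟩ ⟨T', o'⟩ h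
  obtain ⟨h1, h2⟩ := Prod.mk.inj h
  obtain rfl : T = T' := FinFamilyTree.ext (Finset.coe_injective h1)
  obtain rfl : o = o' := Subtype.ext h2
  rfl

theorem cons_mem_treeOf {c : List ℕ → ℕ} {i : ℕ} {w : List ℕ} :
    i :: w ∈ treeOf c ↔ w ∈ treeOf c ∧ i < c w := by
  constructor
  · exact fun h => ⟨fun j v hv => h j v (hv.trans (List.suffix_cons i w)),
      h i w List.suffix_rfl⟩
  · rintro ⟨h1, h2⟩ j v hv
    rcases List.suffix_cons_iff.1 hv with hv | hv
    · obtain ⟨rfl, rfl⟩ := List.cons.inj hv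
      exact h2
    · exact h1 j v hv

/-- Values of `c` off `T` are never consulted when growing from the top, so being equal to `T` is a
condition on finitely many values of `c`. -/
theorem treeOf_eq_iff (c : List ℕ → ℕ) (T : FinFamilyTree) :
    treeOf c = ↑T.verts ↔ ∀ w ∈ T.verts, c w = T.deg w := by
  constructor
  · intro h w hw
    have h1 : ∀ i, i < c w ↔ i < T.deg w := fun i => by
      rw [← T.cons_mem_iff, ← Finset.mem_coe, ← h, cons_mem_treeOf]
      rw [← Finset.mem_coe, ← h] at hw
      simp [hw]
    exact le_antisymm (le_of_not_gt fun hlt => lt_irrefl _ ((h1 _).1 hlt))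
      (le_of_not_gt fun hlt => lt_irrefl _ ((h1 _).2 hlt))
  · intro h
    ext v
    induction v with
    | nil => exact iff_of_true (fun i w hw => by simp at hw) T.top_mem
    | cons i v ih =>
      rw [cons_mem_treeOf, ih]
      constructor
      · rintro ⟨hv, hi⟩
        rw [h v hv] at hi
        exact (T.cons_mem_iff i v).2 hi
      · intro hi
        have hv : v ∈ T.verts := T.parent_mem i v hi
        rw [h v hv]
        exact ⟨hv, (T.cons_mem_iff i v).1 hi⟩

/-! ### The law of the Typically rooted Galton-Watson Tree -/

/-- With `drop_succ_proper`, this matches the ancestors of `o` with the indices `j < o.length` of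
the seed pairs. -/
theorem eq_drop_of_suffix {w o : List ℕ} (h : w <:+ o ∧ w ≠ o) :
    o.length - w.length - 1 < o.length ∧ o.drop (o.length - w.length - 1 + 1) = w := by
  have h1 : w.length < o.length :=
    lt_of_le_of_ne h.1.length_le fun h2 => h.2 (h.1.eq_of_length h2)
  refine ⟨by omega, ?_⟩
  rw [show o.length - w.length - 1 + 1 = o.length - w.length by omega]
  exact (List.suffix_iff_eq_drop.1 h.1).symm

theorem drop_succ_proper {o : List ℕ} {j : ℕ} (hj : j < o.length) :
    o.drop (j + 1) <:+ o ∧ o.drop (j + 1) ≠ o :=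
  ⟨List.drop_suffix _ _, fun h => by
    have := congrArg List.length h
    rw [List.length_drop] at this
    omega⟩

theorem seedRoot_eq_iff (s : Seed) (o : List ℕ) :
    seedRoot s = o ↔ s.1 = o.length ∧ ∀ j < o.length, (s.2.1 j).2 = o.getD j 0 := by
  constructor
  · rintro rfl
    refine ⟨by simp [seedRoot], fun j hj => ?_⟩
    rw [List.getD_eq_getElem _ _ hj]
    simp [seedRoot]
  · rintro ⟨h1, h2⟩
    refine List.ext_getElem (by simp [seedRoot, h1]) fun j hj hj' => ?_
    have := h2 j hj'
    rw [List.getD_eq_getElem _ _ hj'] at this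
    simp [seedRoot, this]

-- The event is a finite cylinder: ancestors read the pairs, all other vertices read their own
-- coordinate, so independence will give a product.
open Classical in
theorem seedTree_preimage (T : FinFamilyTree) {o : List ℕ} (hoT : o ∈ T.verts) :
    seedTree ⁻¹' {(↑T.verts, o)} = {o.length} ×ˢ
      (Set.pi ↑(Finset.range o.length) (fun j => {(T.deg (o.drop (j + 1)), o.getD j 0)}) ×ˢ
        Set.pi ↑(T.verts.filter fun w => ¬ (w <:+ o ∧ w ≠ o)) (fun w => {T.deg w})) := by
  ext s
  simp only [Set.mem_preimage, Set.mem_singleton_iff, seedTree, Prod.ext_iff, Set.mem_prod,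
    Set.mem_pi, Finset.mem_coe, Finset.mem_range, Finset.mem_filter, treeOf_eq_iff]
  constructor
  · rintro ⟨hT, hr⟩
    have hr' := (seedRoot_eq_iff s o).1 hr
    have ho : ∀ j < o.length, o.drop (j + 1) ∈ T.verts → (s.2.1 j).1 = T.deg (o.drop (j + 1)) := by
      intro j hj hm
      rw [← hT _ hm, seedChildren, hr, if_pos (drop_succ_proper hj), hr'.1, List.length_drop,
        show o.length - (o.length - (j + 1)) - 1 = j by omega]
    refine ⟨hr'.1, fun j hj => ⟨ho j hj ?_, hr'.2 j hj⟩, fun w hw => ?_⟩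
    · exact T.mem_of_suffix (List.drop_suffix _ _) hoT
    · rw [← hT w hw.1, seedChildren, hr, if_neg hw.2]
  · rintro ⟨hn, hZ, hc⟩
    have hr := (seedRoot_eq_iff s o).2 ⟨hn, fun j hj => (hZ j hj).2⟩
    refine ⟨fun w hw => ?_, hr⟩
    by_cases h : w <:+ o ∧ w ≠ o
    · obtain ⟨h1, h2⟩ := eq_drop_of_suffix h
      rw [seedChildren, hr, if_pos h, hn, (hZ _ h1).1, h2]
    · rw [seedChildren, hr, if_neg h, hc w ⟨hw, h⟩]

theorem geometric_singleton {π : PMF ℕ} (hπ : mean π < 1) (n : ℕ) :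
    geometricMeasure ⟨1 - (mean π).toReal,
      sub_nonneg.2 (ENNReal.toReal_le_of_le_ofReal zero_le_one (by simpa using hπ.le)),
      sub_le_self 1 ENNReal.toReal_nonneg⟩ {n} = mean π ^ n * (1 - mean π) := by
  have h1 : (mean π).toReal < 1 := by
    simpa using (ENNReal.toReal_lt_toReal hπ.ne_top ENNReal.one_ne_top).2 hπ
  rw [geometricMeasure_singleton]
  · simp only [sub_sub_cancel]
    rw [ENNReal.ofReal_mul (by positivity), ENNReal.ofReal_pow ENNReal.toReal_nonneg,
      ENNReal.ofReal_sub _ ENNReal.toReal_nonneg, ENNReal.ofReal_toReal hπ.ne_top,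
      ENNReal.ofReal_one]
  · intro h
    have := congrArg Subtype.val h
    simp only [Set.Icc.coe_zero] at this
    linarith

/-- The factors `m`, `k / m` and `1 / k` cancel. If `m = 0`, then `sizeBiased` is a default value,
but `π k = 0` because `k > 0`. -/
theorem mean_mul_ancestorLaw {π : PMF ℕ} (hπ : mean π ≠ ∞) {k u : ℕ} (hu : u < k) :
    mean π * ancestorLaw π (k, u) = π k := by
  have hk : 0 < k := by omega
  by_cases h0 : mean π = 0
  · have h1 := ENNReal.tsum_eq_zero.1 h0 k
    rw [h0, zero_mul]
    exact (by simpa [hk.ne'] using h1 : π k = 0).symm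
  · have h1 : ancestorLaw π (k, u) = sizeBiased π k * (k : ℝ≥0∞)⁻¹ := by
      rw [ancestorLaw, PMF.bind_apply, tsum_eq_single k]
      · congr 1
        rw [PMF.map_apply, tsum_eq_single u]
        · simp [uniformPosition, hk, hu]
        · intro b hb
          simp [hb.symm]
      · intro b hb
        rw [PMF.map_apply]
        simp [hb.symm]
    have h2 : sizeBiased π k = k * π k * (mean π)⁻¹ := by
      rw [sizeBiased, dif_pos ⟨h0, hπ⟩]
      exact PMF.normalize_apply _ _ _
    have hk' : (k : ℝ≥0∞) ≠ 0 := by exact_mod_cast hk.ne'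
    rw [h1, h2]
    calc mean π * (k * π k * (mean π)⁻¹ * (k : ℝ≥0∞)⁻¹)
        = (mean π * (mean π)⁻¹) * (k * (k : ℝ≥0∞)⁻¹) * π k := by ring
      _ = π k := by
        rw [ENNReal.mul_inv_cancel h0 hπ, ENNReal.mul_inv_cancel hk' (ENNReal.natCast_ne_top k)]
        simp

instance : MeasurableSingletonClass (Set (List ℕ)) :=
  inferInstanceAs (MeasurableSingletonClass (List ℕ → Prop))

/-- The mass of a finite rooted tree under `TGWT(π)` does not depend on the root. -/
theorem TGWT_singleton {π : PMF ℕ} (hπ : mean π < 1) (x : RootedFamilyTree) :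
    TGWT π hπ {x.code} = (1 - mean π) * ∏ v ∈ x.tree.verts, π (x.tree.deg v) := by
  classical
  obtain ⟨T, o, ho⟩ := x
  have hanc : ∏ j ∈ Finset.range o.length, π (T.deg (o.drop (j + 1))) =
      ∏ w ∈ T.verts.filter (fun w => w <:+ o ∧ w ≠ o), π (T.deg w) := by
    refine Finset.prod_bij (fun j _ => o.drop (j + 1)) ?_ ?_ ?_ fun _ _ => rfl
    · intro j hj
      have := drop_succ_proper (Finset.mem_range.1 hj)
      exact Finset.mem_filter.2 ⟨T.mem_of_suffix this.1 ho, this⟩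
    · intro j hj j' hj' h
      have := congrArg List.length h
      simp only [List.length_drop] at this
      simp only [Finset.mem_range] at hj hj'
      omega
    · intro w hw
      have := eq_drop_of_suffix (Finset.mem_filter.1 hw).2
      exact ⟨_, Finset.mem_range.2 this.1, this.2⟩
  have hstep : ∀ j ∈ Finset.range o.length,
      mean π * ancestorLaw π (T.deg (o.drop (j + 1)), o.getD j 0) =
        π (T.deg (o.drop (j + 1))) := by
    intro j hj
    have hj := Finset.mem_range.1 hj
    -- The position is admissible because prepending it to the ancestor of order `j + 1` gives the
    -- vertex `o.drop j` of `T`.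
    refine mean_mul_ancestorLaw hπ.ne_top ((T.cons_mem_iff _ _).1 ?_)
    rw [List.getD_eq_getElem _ _ hj, ← List.drop_eq_getElem_cons hj]
    exact T.mem_of_suffix (List.drop_suffix _ _) ho
  rw [TGWT, Measure.map_apply measurable_seedTree (measurableSet_singleton _)]
  simp only [RootedFamilyTree.code]
  rw [seedTree_preimage T ho, seedLaw, Measure.prod_prod, Measure.prod_prod,
    Measure.infinitePi_pi _ (fun _ _ => measurableSet_singleton _),
    Measure.infinitePi_pi _ (fun _ _ => measurableSet_singleton _), geometric_singleton hπ]
  simp only [PMF.toMeasure_apply_singleton _ _ (measurableSet_singleton _)]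
  -- Each of the `o.length` factors `mean π` is absorbed by one ancestor.
  rw [← Finset.prod_filter_mul_prod_filter_not T.verts (fun w => w <:+ o ∧ w ≠ o), ← hanc,
    ← Finset.prod_congr rfl hstep, Finset.prod_mul_distrib, Finset.prod_const, Finset.card_range]
  ring

end FamilyTrees

namespace FamilyTrees

/-! ### Random variables with countably many values -/

section Countable

variable {Ω α β : Type*} [MeasurableSpace Ω] {P : Measure Ω}

theorem lintegral_comp_eq_tsum [MeasurableSpace α] [Countable α] [DiscreteMeasurableSpace α]
    {X : Ω → α} (hX : Measurable X) (g : α → ℝ≥0∞) :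
    ∫⁻ ω, g (X ω) ∂P = ∑' x, g x * P (X ⁻¹' {x}) := by
  rw [← lintegral_map (f := g) (.of_discrete) hX, lintegral_countable']
  simp_rw [Measure.map_apply hX (measurableSet_singleton _)]

theorem measure_preimage_eq_lintegral [MeasurableSpace α] [DiscreteMeasurableSpace α]
    {X : Ω → α} (hX : Measurable X) (s : Set α) [DecidablePred (· ∈ s)] :
    P (X ⁻¹' s) = ∫⁻ ω, (if X ω ∈ s then 1 else 0) ∂P := by
  rw [← lintegral_indicator_one (hX (.of_discrete))]
  refine lintegral_congr fun ω => ?_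
  by_cases h : X ω ∈ s <;> simp [h]

/-- Variables with countably many values are independent if their joint mass function is a
product. -/
theorem indepFun_of_measure_inter_eq_mul [IsProbabilityMeasure P] [MeasurableSpace α] [Countable α]
    [DiscreteMeasurableSpace α] [MeasurableSpace β] [Countable β] [DiscreteMeasurableSpace β]
    {U : Ω → α} {V : Ω → β} (hU : Measurable U) (hV : Measurable V) (F : α → ℝ≥0∞)
    (H : β → ℝ≥0∞) (h : ∀ a b, P (U ⁻¹' {a} ∩ V ⁻¹' {b}) = F a * H b) : IndepFun U V P := by
  have hUV : Measurable fun ω => (U ω, V ω) := hU.prodMk hV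
  have hpre : ∀ a b, (fun ω => (U ω, V ω)) ⁻¹' {(a, b)} = U ⁻¹' {a} ∩ V ⁻¹' {b} := fun a b => by
    ext ω
    simp
  have hU' : ∀ a, P (U ⁻¹' {a}) = F a * ∑' b, H b := fun a => by
    rw [← ENNReal.tsum_mul_left, ← Set.inter_univ (U ⁻¹' {a}),
      ← Set.preimage_univ (f := V), ← Set.iUnion_of_singleton β, Set.preimage_iUnion,
      Set.inter_iUnion, measure_iUnion]
    · simp_rw [h]
    · intro b b' hb
      refine Set.disjoint_left.2 fun ω h1 h2 => hb ?_
      exact h1.2.symm.trans h2.2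
    · exact fun b => (hU (.of_discrete)).inter (hV (.of_discrete))
  have hV' : ∀ b, P (V ⁻¹' {b}) = (∑' a, F a) * H b := fun b => by
    rw [← ENNReal.tsum_mul_right, ← Set.univ_inter (V ⁻¹' {b}),
      ← Set.preimage_univ (f := U), ← Set.iUnion_of_singleton α, Set.preimage_iUnion,
      Set.iUnion_inter, measure_iUnion]
    · simp_rw [h]
    · intro a a' hb
      refine Set.disjoint_left.2 fun ω h1 h2 => hb ?_
      exact h1.1.symm.trans h2.1
    · exact fun b => (hU (.of_discrete)).inter (hV (.of_discrete))
  -- `F` and `H` need not be normalized separately; only the product of their totals enters.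
  have htot : (∑' a, F a) * ∑' b, H b = 1 := by
    rw [← ENNReal.tsum_mul_right]
    simp_rw [← hU']
    have := lintegral_comp_eq_tsum (P := P) hU fun _ => 1
    simpa using this.symm
  rw [indepFun_iff_map_prod_eq_prod_map_map hU.aemeasurable hV.aemeasurable]
  refine Measure.ext_of_singleton fun ⟨a, b⟩ => ?_
  rw [Measure.map_apply hUV (.of_discrete), hpre, h, ← Set.singleton_prod_singleton,
    Measure.prod_prod, Measure.map_apply hU (.of_discrete), Measure.map_apply hV (.of_discrete),
    hU', hV']
  calc F a * H b = F a * H b * ((∑' a, F a) * ∑' b, H b) := by rw [htot, mul_one]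
    _ = _ := by ring

end Countable

/-! ### Unimodularity -/

section Unimodular

variable {Ω : Type*} [MeasurableSpace Ω] {P : Measure Ω} {X : Ω → RootedFamilyTree}

/-- For a fixed tree, both sides of the transport identity are double sums over its vertices with a
common weight, so they differ by exchanging the summations. -/
theorem isUnimodular_of_forall_root (hX : Measurable X)
    (h : ∀ (T : FinFamilyTree) (u v : T.Vertex), P (X ⁻¹' {⟨T, u⟩}) = P (X ⁻¹' {⟨T, v⟩})) :
    IsUnimodular P X := by
  intro f
  rw [lintegral_comp_eq_tsum hX fun x => ∑ u : x.tree.Vertex, (f ⟨x.tree, x.root, u⟩ : ℝ≥0∞),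
    lintegral_comp_eq_tsum hX fun x => ∑ u : x.tree.Vertex, (f ⟨x.tree, u, x.root⟩ : ℝ≥0∞),
    ← rootedEquiv.symm.tsum_eq, ← rootedEquiv.symm.tsum_eq, ENNReal.tsum_sigma', ENNReal.tsum_sigma']
  refine tsum_congr fun T => ?_
  have hT : ∑ u : T.Vertex, ∑ v : T.Vertex, (f ⟨T, u, v⟩ : ℝ≥0∞) * P (X ⁻¹' {⟨T, u⟩}) =
      ∑ u : T.Vertex, ∑ v : T.Vertex, (f ⟨T, v, u⟩ : ℝ≥0∞) * P (X ⁻¹' {⟨T, u⟩}) := by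
    rw [Finset.sum_comm]
    exact Finset.sum_congr rfl fun u _ => Finset.sum_congr rfl fun v _ => by rw [h T u v]
  simp only [tsum_fintype, rootedEquiv, Equiv.coe_fn_symm_mk, Finset.sum_mul]
  exact hT

open Classical in
theorem IsUnimodular.lintegral_ite (hU : IsUnimodular P X) (r : DoublyRootedFamilyTree → Prop) :
    ∫⁻ ω, ∑ u : (X ω).tree.Vertex,
        (if r ⟨(X ω).tree, (X ω).root, u⟩ then (1 : ℝ≥0∞) else 0) ∂P =
      ∫⁻ ω, ∑ u : (X ω).tree.Vertex,
        (if r ⟨(X ω).tree, u, (X ω).root⟩ then (1 : ℝ≥0∞) else 0) ∂P := by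
  have := hU fun y => if r y then 1 else 0
  simpa only [apply_ite ((↑) : ℝ≥0 → ℝ≥0∞), ENNReal.coe_one, ENNReal.coe_zero] using this

open Classical in
/-- Moving the root of a unimodular tree between two given vertices preserves the measure. -/
theorem IsUnimodular.measure_root_eq (hX : Measurable X) (hU : IsUnimodular P X) {u v : List ℕ}
    {S : Set FinFamilyTree} (hS : ∀ T ∈ S, u ∈ T.verts ∧ v ∈ T.verts) :
    P (X ⁻¹' {x | x.root.1 = u ∧ x.tree ∈ S}) = P (X ⁻¹' {x | x.root.1 = v ∧ x.tree ∈ S}) := by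
  have key : ∀ (T : FinFamilyTree) (a : List ℕ) (p : Prop), (p → a ∈ T.verts) →
      ∑ w : T.Vertex, (if w.1 = a ∧ p then (1 : ℝ≥0∞) else 0) = if p then 1 else 0 := by
    intro T a p ha
    by_cases hp : p
    · rw [if_pos hp, Finset.sum_eq_single ⟨a, ha hp⟩]
      · simp [hp]
      · intro b _ hb
        rw [if_neg]
        exact fun h => hb (Subtype.ext h.1)
      · simp
    · simp [hp]
  -- In trees of `S`, send unit mass from `u` to `v`. Both vertices exist there, so each inner sum
  -- is an indicator.
  have := hU.lintegral_ite fun y => y.snd.1 = v ∧ y.fst.1 = u ∧ y.tree ∈ S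
  rw [measure_preimage_eq_lintegral hX, measure_preimage_eq_lintegral hX]
  simp only [Set.mem_ofPred_eq]
  refine Eq.trans (lintegral_congr fun ω => ?_) (this.trans (lintegral_congr fun ω => ?_))
  · have h := key (X ω).tree v ((X ω).root.1 = u ∧ (X ω).tree ∈ S) fun h => (hS _ h.2).2
    convert h.symm
  · have h := key (X ω).tree u ((X ω).root.1 = v ∧ (X ω).tree ∈ S) fun h => (hS _ h.2).1
    simp only [and_left_comm (a := (X ω).root.1 = v)]
    convert h

open Classical in
/-- The mean number of children of the root is the probability that the root has a parent. -/
theorem IsUnimodular.lintegral_numChildren (hX : Measurable X) (hU : IsUnimodular P X) :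
    ∫⁻ ω, ((X ω).numChildren : ℝ≥0∞) ∂P = P (X ⁻¹' {x | x.root.1 ≠ []}) := by
  -- Every vertex sends unit mass to each of its children: the root sends `d₁(o)` and receives `1`
  -- exactly when it has a parent.
  have := hU.lintegral_ite fun y => ∃ i : ℕ, y.snd.1 = i :: y.fst.1
  rw [measure_preimage_eq_lintegral hX]
  convert this using 1
  · refine lintegral_congr fun ω => ?_
    rw [RootedFamilyTree.numChildren, ← Finset.sum_boole]
    exact (Finset.sum_coe_sort (X ω).tree.verts
      fun v => if ∃ i : ℕ, v = i :: (X ω).root.1 then (1 : ℝ≥0∞) else 0).symm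
  · refine lintegral_congr fun ω => ?_
    obtain ⟨T, o, ho⟩ := X ω
    cases o with
    | nil => simp
    | cons i w =>
      rw [Finset.sum_eq_single ⟨w, T.parent_mem i w ho⟩]
      · simp
      · intro b _ hb
        refine if_neg ?_
        rintro ⟨j, hj⟩
        exact hb (Subtype.ext (List.cons.inj hj).2.symm)
      · simp

end Unimodular

/-! ### Descendants and non-descendants of the root -/

theorem deg_eq_deg_of_forall {T T' : FinFamilyTree} {w w' : List ℕ}
    (h : ∀ i : ℕ, i :: w ∈ T.verts ↔ i :: w' ∈ T'.verts) : T.deg w = T'.deg w' := by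
  simp only [FinFamilyTree.cons_mem_iff] at h
  exact le_antisymm (le_of_not_gt fun hlt => lt_irrefl _ ((h _).1 hlt))
    (le_of_not_gt fun hlt => lt_irrefl _ ((h _).2 hlt))

namespace RootedFamilyTree

theorem ext_of_verts {x y : RootedFamilyTree} (h : x.root.1 = y.root.1)
    (h' : ∀ v, v ∈ x.tree.verts ↔ v ∈ y.tree.verts) : x = y :=
  code_injective (Prod.ext (Set.ext h') h)

theorem mem_nonDescendantTree {x : RootedFamilyTree} {v : List ℕ} :
    v ∈ x.nonDescendantTree.tree.verts ↔
      v ∈ x.tree.verts ∧ (v = x.root.1 ∨ ¬ x.root.1 <:+ v) := by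
  simp [nonDescendantTree]

@[simp]
theorem root_nonDescendantTree (x : RootedFamilyTree) :
    x.nonDescendantTree.root.1 = x.root.1 := rfl

/-- No child of `v` is lost: the only one that can have the root as a suffix is the root itself,
which is kept. -/
theorem deg_nonDescendantTree {x : RootedFamilyTree} {v : List ℕ} (hv : ¬ x.root.1 <:+ v) :
    x.nonDescendantTree.tree.deg v = x.tree.deg v := by
  refine deg_eq_deg_of_forall fun i => ?_
  rw [mem_nonDescendantTree, List.suffix_cons_iff]
  simp only [hv, or_false, and_iff_left_iff_imp]
  exact fun _ => (em _).imp_right fun h h' => h h'.symm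

/-- The tree formed by the root and its descendants. -/
noncomputable def descendantTree (x : RootedFamilyTree) : FinFamilyTree where
  verts := x.tree.verts.preimage (· ++ x.root.1) (List.append_left_injective _).injOn
  top_mem := by simp
  parent_mem i w h := by
    rw [Finset.mem_preimage] at h ⊢
    exact x.tree.parent_mem i _ h
  sibling_mem i j w h := by
    rw [Finset.mem_preimage] at h ⊢
    exact x.tree.sibling_mem i j _ h

theorem mem_descendantTree {x : RootedFamilyTree} {w : List ℕ} :
    w ∈ x.descendantTree.verts ↔ w ++ x.root.1 ∈ x.tree.verts := by
  simp [descendantTree]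

theorem deg_descendantTree (x : RootedFamilyTree) (w : List ℕ) :
    x.descendantTree.deg w = x.tree.deg (w ++ x.root.1) :=
  deg_eq_deg_of_forall fun i => by rw [mem_descendantTree, List.cons_append]

open Classical in
/-- The tree obtained from `x` by replacing the descendant tree of the root by `D`. -/
noncomputable def graft (x : RootedFamilyTree) (D : FinFamilyTree) : RootedFamilyTree where
  tree :=
    { verts := x.nonDescendantTree.tree.verts ∪ D.verts.image (· ++ x.root.1)
      top_mem := Finset.mem_union_left _ x.nonDescendantTree.tree.top_mem
      parent_mem := by
        intro i w h
        rcases Finset.mem_union.1 h with h | h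
        · exact Finset.mem_union_left _ (x.nonDescendantTree.tree.parent_mem i w h)
        · obtain ⟨v, hv, h⟩ := Finset.mem_image.1 h
          cases v with
          | nil =>
            refine Finset.mem_union_left _ (x.nonDescendantTree.tree.parent_mem i w ?_)
            rw [← h]
            exact x.nonDescendantTree.root.2
          | cons j v =>
            obtain ⟨-, rfl⟩ := List.cons.inj h
            exact Finset.mem_union_right _ (Finset.mem_image_of_mem _ (D.parent_mem j v hv))
      sibling_mem := by
        intro i j w h hj
        rcases Finset.mem_union.1 h with h | h
        · exact Finset.mem_union_left _ (x.nonDescendantTree.tree.sibling_mem i j w h hj)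
        · obtain ⟨v, hv, h⟩ := Finset.mem_image.1 h
          cases v with
          | nil =>
            refine Finset.mem_union_left _ (x.nonDescendantTree.tree.sibling_mem i j w ?_ hj)
            rw [← h]
            exact x.nonDescendantTree.root.2
          | cons k v =>
            obtain ⟨rfl, rfl⟩ := List.cons.inj h
            exact Finset.mem_union_right _
              (Finset.mem_image.2 ⟨j :: v, D.sibling_mem k j v hv hj, rfl⟩) }
  root := ⟨x.root.1, Finset.mem_union_left _ x.nonDescendantTree.root.2⟩

@[simp]
theorem root_graft (x : RootedFamilyTree) (D : FinFamilyTree) :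
    (x.graft D).root.1 = x.root.1 := rfl

theorem mem_graft {x : RootedFamilyTree} {D : FinFamilyTree} {v : List ℕ} :
    v ∈ (x.graft D).tree.verts ↔
      v ∈ x.nonDescendantTree.tree.verts ∨ ∃ w ∈ D.verts, w ++ x.root.1 = v := by
  simp [graft]

theorem append_root_mem_graft {x : RootedFamilyTree} {D : FinFamilyTree} {w : List ℕ} :
    w ++ x.root.1 ∈ (x.graft D).tree.verts ↔ w ∈ D.verts := by
  rw [mem_graft, mem_nonDescendantTree]
  constructor
  · rintro (⟨-, h | h⟩ | ⟨v, hv, h⟩)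
    · rw [List.append_left_eq_self.1 h]
      exact D.top_mem
    · exact absurd (List.suffix_append _ _) h
    · rwa [← List.append_cancel_right h]
  · exact fun h => Or.inr ⟨w, h, rfl⟩

theorem descendantTree_graft (x : RootedFamilyTree) (D : FinFamilyTree) :
    (x.graft D).descendantTree = D :=
  FinFamilyTree.ext (Finset.ext fun w => by
    rw [mem_descendantTree, root_graft, append_root_mem_graft])

theorem nonDescendantTree_graft (x : RootedFamilyTree) (D : FinFamilyTree) :
    (x.graft D).nonDescendantTree = x.nonDescendantTree := by
  refine ext_of_verts rfl fun v => ?_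
  rw [mem_nonDescendantTree, mem_graft, mem_nonDescendantTree, root_graft]
  constructor
  · rintro ⟨h | ⟨w, -, rfl⟩, h'⟩
    · exact h
    · rcases h' with h' | h'
      · exact ⟨by rw [h']; exact x.root.2, Or.inl h'⟩
      · exact absurd (List.suffix_append _ _) h'
  · exact fun h => ⟨Or.inl h, h.2⟩

theorem nonDescendantTree_nonDescendantTree (x : RootedFamilyTree) :
    x.nonDescendantTree.nonDescendantTree = x.nonDescendantTree := by
  refine ext_of_verts rfl fun v => ?_
  rw [mem_nonDescendantTree, mem_nonDescendantTree, root_nonDescendantTree]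
  tauto

theorem graft_nonDescendantTree (x : RootedFamilyTree) :
    x.nonDescendantTree.graft x.descendantTree = x := by
  refine ext_of_verts rfl fun v => ?_
  rw [mem_graft, nonDescendantTree_nonDescendantTree, mem_nonDescendantTree,
    root_nonDescendantTree]
  constructor
  · rintro (h | ⟨w, hw, rfl⟩)
    · exact h.1
    · exact mem_descendantTree.1 hw
  · intro h
    by_cases hv : x.root.1 <:+ v
    · obtain ⟨w, rfl⟩ := hv
      exact Or.inr ⟨w, mem_descendantTree.2 h, rfl⟩
    · exact Or.inl ⟨h, Or.inr hv⟩

/-- A rooted tree amounts to its non-descendant tree and its descendant tree. -/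
noncomputable def graftEquiv :
    RootedFamilyTree ≃ {x : RootedFamilyTree // x.nonDescendantTree = x} × FinFamilyTree where
  toFun x := (⟨x.nonDescendantTree, x.nonDescendantTree_nonDescendantTree⟩, x.descendantTree)
  invFun y := y.1.1.graft y.2
  left_inv x := x.graft_nonDescendantTree
  right_inv y := Prod.ext
    (Subtype.ext ((nonDescendantTree_graft _ _).trans y.1.2)) (descendantTree_graft _ _)

/-- The root lies in both trees but has its true degree only in the descendant tree, hence the
`erase`. -/
theorem prod_verts_eq {M : Type*} [CommMonoid M] (g : ℕ → M) (x : RootedFamilyTree) :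
    ∏ v ∈ x.tree.verts, g (x.tree.deg v) =
      (∏ v ∈ x.nonDescendantTree.tree.verts.erase x.root.1, g (x.nonDescendantTree.tree.deg v)) *
        ∏ w ∈ x.descendantTree.verts, g (x.descendantTree.deg w) := by
  classical
  rw [← Finset.prod_filter_not_mul_prod_filter x.tree.verts (fun v => x.root.1 <:+ v)]
  congr 1
  · have : x.tree.verts.filter (fun v => ¬ x.root.1 <:+ v) =
        x.nonDescendantTree.tree.verts.erase x.root.1 := by
      ext v
      rw [Finset.mem_filter, Finset.mem_erase, mem_nonDescendantTree]
      constructor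
      · rintro ⟨h1, h2⟩
        exact ⟨fun h => h2 (h ▸ List.suffix_rfl), h1, Or.inr h2⟩
      · rintro ⟨h1, h2, h3⟩
        exact ⟨h2, h3.resolve_left h1⟩
    rw [← this]
    exact Finset.prod_congr rfl fun v hv => by
      rw [deg_nonDescendantTree (Finset.mem_filter.1 hv).2]
  · symm
    refine Finset.prod_bij (fun w _ => w ++ x.root.1) ?_ ?_ ?_ ?_
    · exact fun w hw => Finset.mem_filter.2 ⟨mem_descendantTree.1 hw, List.suffix_append _ _⟩
    · exact fun w _ w' _ h => List.append_cancel_right h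
    · intro v hv
      obtain ⟨h1, w, rfl⟩ := Finset.mem_filter.1 hv
      exact ⟨w, mem_descendantTree.2 h1, rfl⟩
    · exact fun w _ => by rw [deg_descendantTree]

theorem numChildren_eq_deg_descendantTree (x : RootedFamilyTree) :
    x.numChildren = x.descendantTree.deg [] := by
  rw [deg_descendantTree, numChildren_eq, List.nil_append]

end RootedFamilyTree

end FamilyTrees

namespace FamilyTrees

/-! ### Mass functions and the product form -/

section Characterization

variable {Ω : Type*} [MeasurableSpace Ω] {P : Measure Ω} {X : Ω → RootedFamilyTree}

theorem measurable_code_comp (hX : Measurable X) : Measurable fun ω => (X ω).code :=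
  (Measurable.of_discrete (f := RootedFamilyTree.code)).comp hX

theorem map_code_singleton (hX : Measurable X) (x : RootedFamilyTree) :
    P.map (fun ω => (X ω).code) {x.code} = P (X ⁻¹' {x}) := by
  rw [Measure.map_apply (measurable_code_comp hX) (measurableSet_singleton _)]
  congr 1
  ext ω
  exact RootedFamilyTree.code_injective.eq_iff

/-- A random finite rooted tree is a `TGWT(π)` if and only if it has the right mass function. -/
theorem map_code_eq_TGWT_iff [IsProbabilityMeasure P] (hX : Measurable X) {π : PMF ℕ}
    (hπ : mean π < 1) :
    P.map (fun ω => (X ω).code) = TGWT π hπ ↔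
      ∀ x, P (X ⁻¹' {x}) = (1 - mean π) * ∏ v ∈ x.tree.verts, π (x.tree.deg v) := by
  constructor
  · intro h x
    rw [← map_code_singleton hX, h, TGWT_singleton]
  · intro h
    have : IsProbabilityMeasure (P.map fun ω => (X ω).code) :=
      Measure.isProbabilityMeasure_map (measurable_code_comp hX).aemeasurable
    have hC : (Set.range RootedFamilyTree.code).Countable := Set.countable_range _
    have hP : P.map (fun ω => (X ω).code) (Set.range RootedFamilyTree.code) = 1 := by
      rw [Measure.map_apply (measurable_code_comp hX) hC.measurableSet]
      convert measure_univ (μ := P)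
      exact Set.eq_univ_of_forall fun ω => ⟨X ω, rfl⟩
    have hres : (P.map fun ω => (X ω).code).restrict (Set.range RootedFamilyTree.code) =
        (TGWT π hπ).restrict (Set.range RootedFamilyTree.code) := by
      have hun : Set.range RootedFamilyTree.code = ⋃ x : RootedFamilyTree, {x.code} := by
        simp
      rw [hun, Measure.restrict_iUnion_congr]
      intro x
      rw [Measure.restrict_singleton, Measure.restrict_singleton, map_code_singleton hX, h,
        TGWT_singleton]
    -- Infinite trees get no mass under `TGWT π` because the masses of the finite ones already sum
    -- to `1`; extinction needs no separate argument.
    have hT : TGWT π hπ (Set.range RootedFamilyTree.code) = 1 := by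
      rw [← hP, ← Measure.restrict_apply_self, ← hres, Measure.restrict_apply_self]
    have hP' : ∀ᵐ y ∂P.map fun ω => (X ω).code, y ∈ Set.range RootedFamilyTree.code :=
      (prob_compl_eq_zero_iff hC.measurableSet).2 hP
    have hT' : ∀ᵐ y ∂TGWT π hπ, y ∈ Set.range RootedFamilyTree.code :=
      (prob_compl_eq_zero_iff hC.measurableSet).2 hT
    rw [← Measure.restrict_eq_self_of_ae_mem hP', hres, Measure.restrict_eq_self_of_ae_mem hT']

/-- If the mass of a rooted tree is a product over its vertices of a function of the number of
children, then the number of children of the root is independent of its non-descendant tree. -/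
theorem indepFun_of_prod_verts [IsProbabilityMeasure P] (hX : Measurable X) (c : ℝ≥0∞)
    (g : ℕ → ℝ≥0∞)
    (h : ∀ x, P (X ⁻¹' {x}) = c * ∏ v ∈ x.tree.verts, g (x.tree.deg v)) :
    IndepFun (fun ω => (X ω).numChildren) (fun ω => (X ω).nonDescendantTree) P := by
  classical
  refine indepFun_of_measure_inter_eq_mul (α := ℕ)
    (Measurable.of_discrete (f := RootedFamilyTree.numChildren) |>.comp hX)
    (Measurable.of_discrete (f := RootedFamilyTree.nonDescendantTree) |>.comp hX)
    -- Total weights of the admissible descendant trees and of the admissible non-descendant trees;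
    -- `graftEquiv` turns the sum over rooted trees into their product.
    (fun k => ∑' D : FinFamilyTree, if D.deg [] = k then ∏ w ∈ D.verts, g (D.deg w) else 0)
    (fun s => ∑' b : {x : RootedFamilyTree // x.nonDescendantTree = x}, if b.1 = s then
      c * ∏ v ∈ b.1.tree.verts.erase b.1.root.1, g (b.1.tree.deg v) else 0) fun k s => ?_
  have hset : (fun ω => (X ω).numChildren) ⁻¹' {k} ∩ (fun ω => (X ω).nonDescendantTree) ⁻¹' {s} =
      X ⁻¹' {x | x.numChildren = k ∧ x.nonDescendantTree = s} := rfl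
  rw [hset, measure_preimage_eq_lintegral hX, lintegral_comp_eq_tsum hX
    (fun x => if x ∈ {x : RootedFamilyTree | x.numChildren = k ∧ x.nonDescendantTree = s}
      then (1 : ℝ≥0∞) else 0), mul_comm, ← ENNReal.tsum_mul_right]
  simp_rw [← ENNReal.tsum_mul_left]
  rw [← ENNReal.tsum_prod, ← RootedFamilyTree.graftEquiv.tsum_eq]
  refine tsum_congr fun x => ?_
  rw [h, RootedFamilyTree.prod_verts_eq]
  simp only [RootedFamilyTree.graftEquiv, Equiv.coe_fn_mk, Set.mem_ofPred_eq,
    x.numChildren_eq_deg_descendantTree, RootedFamilyTree.root_nonDescendantTree]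
  by_cases h1 : x.descendantTree.deg [] = k
  · by_cases h2 : x.nonDescendantTree = s
    · simp only [h1, h2, and_self, if_true, one_mul]
      rw [mul_assoc]
    · simp [h2]
  · simp [h1]

/-! ### The converse: from unimodularity and independence to the product form -/

/-- The offspring distribution: the law of the number of children of the root. -/
noncomputable def offspringLaw (P : Measure Ω) [IsProbabilityMeasure P]
    {X : Ω → RootedFamilyTree} (hX : Measurable X) : PMF ℕ :=
  have : IsProbabilityMeasure (P.map fun ω => (X ω).numChildren) :=
    Measure.isProbabilityMeasure_map
      (Measurable.of_discrete (f := RootedFamilyTree.numChildren) |>.comp hX).aemeasurable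
  (P.map fun ω => (X ω).numChildren).toPMF

variable [IsProbabilityMeasure P]

theorem offspringLaw_apply (hX : Measurable X) (k : ℕ) :
    offspringLaw P hX k = P ((fun ω => (X ω).numChildren) ⁻¹' {k}) := by
  have hm : Measurable fun ω => (X ω).numChildren :=
    Measurable.of_discrete (f := RootedFamilyTree.numChildren) |>.comp hX
  rw [← Measure.map_apply hm (measurableSet_singleton _)]
  rfl

theorem mean_offspringLaw (hX : Measurable X) (hU : IsUnimodular P X) :
    mean (offspringLaw P hX) = P (X ⁻¹' {x | x.root.1 ≠ []}) := by
  have hm : Measurable fun ω => (X ω).numChildren :=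
    Measurable.of_discrete (f := RootedFamilyTree.numChildren) |>.comp hX
  rw [← hU.lintegral_numChildren hX, lintegral_comp_eq_tsum hm fun n : ℕ => (n : ℝ≥0∞)]
  simp_rw [mean, offspringLaw_apply]

theorem measure_root_eq_nil (hX : Measurable X) (hU : IsUnimodular P X) :
    P (X ⁻¹' {x | x.root.1 = []}) = 1 - mean (offspringLaw P hX) := by
  rw [mean_offspringLaw hX hU, ← prob_compl_eq_one_sub (hX (.of_discrete))]
  congr 1
  ext ω
  simp

/-- If the root were almost surely not the top vertex, moving it to the top would show that every
rooted tree has mass zero. -/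
theorem mean_offspringLaw_lt_one (hX : Measurable X) (hU : IsUnimodular P X) :
    mean (offspringLaw P hX) < 1 := by
  obtain ⟨x, hx⟩ : ∃ x, P (X ⁻¹' {x}) ≠ 0 := by
    by_contra! h
    have := lintegral_comp_eq_tsum (P := P) hX fun _ => 1
    simp [h] at this
  rw [← tsub_pos_iff_lt, ← measure_root_eq_nil hX hU, pos_iff_ne_zero]
  refine fun h => hx ?_
  have h1 := hU.measure_root_eq hX (u := []) (v := x.root.1) (S := {x.tree}) fun T hT => by
    rw [Set.mem_singleton_iff.1 hT]
    exact ⟨x.tree.top_mem, x.root.2⟩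
  have h2 : P (X ⁻¹' {y | y.root.1 = x.root.1 ∧ y.tree ∈ ({x.tree} : Set FinFamilyTree)}) = 0 := by
    rw [← h1]
    exact measure_mono_null (fun ω hω => hω.1) h
  refine measure_mono_null (fun ω hω => ?_) h2
  rw [Set.mem_preimage, Set.mem_singleton_iff] at hω
  subst hω
  exact ⟨rfl, rfl⟩

/-- Trees with the same numbers of children as `T` at the vertices in `A`. -/
def agreeOn (T : FinFamilyTree) (A : Finset (List ℕ)) : Set FinFamilyTree :=
  {T' | ∀ w ∈ A, w ∈ T'.verts ∧ T'.deg w = T.deg w}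

theorem agreeOn_verts (T : FinFamilyTree) : agreeOn T T.verts = {T} := by
  refine Set.eq_singleton_iff_unique_mem.2 ⟨fun w hw => ⟨hw, rfl⟩, fun T' h => ?_⟩
  refine FinFamilyTree.ext (Finset.ext fun v => ?_)
  refine ⟨fun hv => ?_, fun hv => (h v hv).1⟩
  induction v with
  | nil => exact T.top_mem
  | cons i v ih =>
    have hv' := ih (T'.parent_mem i v hv)
    rw [T.cons_mem_iff, ← (h v hv').2]
    exact (T'.cons_mem_iff i v).1 hv

/-- This makes agreement on `A` an event of the non-descendant tree, to which independence applies.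
-/
theorem nonDescendantTree_mem_agreeOn_iff (T : FinFamilyTree) (A : Finset (List ℕ))
    (x : RootedFamilyTree) (h : ∀ w ∈ A, ¬ x.root.1 <:+ w) :
    x.nonDescendantTree.tree ∈ agreeOn T A ↔ x.tree ∈ agreeOn T A := by
  refine forall₂_congr fun w hw => ?_
  rw [RootedFamilyTree.deg_nonDescendantTree (h w hw), RootedFamilyTree.mem_nonDescendantTree]
  simp [h w hw]

/-- The vertices of the tree, seen from its top vertex, have independent numbers of children. -/
theorem measure_agreeOn (hX : Measurable X) (hU : IsUnimodular P X)
    (hI : IndepFun (fun ω => (X ω).numChildren) (fun ω => (X ω).nonDescendantTree) P)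
    (T : FinFamilyTree) (A : Finset (List ℕ)) (hAT : A ⊆ T.verts)
    (hA : ∀ (i : ℕ) (w : List ℕ), i :: w ∈ A → w ∈ A) :
    P (X ⁻¹' {x | x.root.1 = [] ∧ x.tree ∈ agreeOn T A}) =
      (1 - mean (offspringLaw P hX)) * ∏ v ∈ A, offspringLaw P hX (T.deg v) := by
  induction hn : A.card generalizing A with
  | zero =>
    rw [Finset.card_eq_zero.1 hn, Finset.prod_empty, mul_one, ← measure_root_eq_nil hX hU]
    simp [agreeOn]
  | succ n ih =>
    -- A longest word has no descendant in `A`, so the rest stays closed under parents and is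
    -- visible in the non-descendant tree of `v`.
    obtain ⟨v, hv, hmax⟩ := A.exists_max_image List.length (Finset.card_pos.1 (by omega))
    have hsuf : ∀ w ∈ A.erase v, ¬ v <:+ w := fun w hw h =>
      (Finset.mem_erase.1 hw).1
        (h.eq_of_length_le (hmax w (Finset.mem_erase.1 hw).2)).symm
    have hA' : ∀ (i : ℕ) (w : List ℕ), i :: w ∈ A.erase v → w ∈ A.erase v := fun i w hw => by
      have h1 := (Finset.mem_erase.1 hw).2
      refine Finset.mem_erase.2 ⟨?_, hA i w h1⟩
      rintro rfl
      have := hmax _ h1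
      simp at this
    -- The prescribed degree of its parent already forces `v` to exist, so the root can be moved
    -- back from `v` once the condition on its degree is dropped.
    have hmem : ∀ T' ∈ agreeOn T (A.erase v), v ∈ T'.verts := by
      intro T' hT'
      cases v with
      | nil => exact T'.top_mem
      | cons i w =>
        have hw : w ∈ A.erase (i :: w) :=
          Finset.mem_erase.2 ⟨fun h => List.cons_ne_self i w h.symm, hA i w hv⟩
        rw [T'.cons_mem_iff, (hT' w hw).2, ← T.cons_mem_iff]
        exact hAT hv
    have hsplit : ∀ T' : FinFamilyTree,
        T' ∈ agreeOn T A ↔ T'.deg v = T.deg v ∧ T' ∈ agreeOn T (A.erase v) := by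
      intro T'
      constructor
      · exact fun h => ⟨(h v hv).2, fun w hw => h w (Finset.mem_erase.1 hw).2⟩
      · rintro ⟨h1, h2⟩ w hw
        by_cases hwv : w = v
        · rw [hwv]
          exact ⟨hmem T' h2, h1⟩
        · exact h2 w (Finset.mem_erase.2 ⟨hwv, hw⟩)
    have hset : X ⁻¹' {x | x.root.1 = v ∧ x.tree ∈ agreeOn T A} =
        (fun ω => (X ω).numChildren) ⁻¹' {T.deg v} ∩
          X ⁻¹' {x | x.root.1 = v ∧ x.tree ∈ agreeOn T (A.erase v)} := by
      ext ω
      simp only [Set.mem_preimage, Set.mem_ofPred_eq, Set.mem_inter_iff, Set.mem_singleton_iff,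
        RootedFamilyTree.numChildren_eq, hsplit]
      constructor
      · rintro ⟨h1, h2, h3⟩
        exact ⟨by rw [h1]; exact h2, h1, h3⟩
      · rintro ⟨h1, h2, h3⟩
        exact ⟨h2, by rw [← h2]; exact h1.trans (by rw [h2]), h3⟩
    have hset' : X ⁻¹' {x | x.root.1 = v ∧ x.tree ∈ agreeOn T (A.erase v)} =
        (fun ω => (X ω).nonDescendantTree) ⁻¹'
          {x | x.root.1 = v ∧ x.tree ∈ agreeOn T (A.erase v)} := by
      ext ω
      refine and_congr_right fun h => ?_
      refine (nonDescendantTree_mem_agreeOn_iff T _ (X ω) fun w hw => ?_).symm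
      rw [show (X ω).root.1 = v from h]
      exact hsuf w hw
    calc P (X ⁻¹' {x | x.root.1 = [] ∧ x.tree ∈ agreeOn T A})
        = P (X ⁻¹' {x | x.root.1 = v ∧ x.tree ∈ agreeOn T A}) :=
          hU.measure_root_eq hX fun T' hT' => ⟨T'.top_mem, (hT' v hv).1⟩
      _ = offspringLaw P hX (T.deg v) *
            P (X ⁻¹' {x | x.root.1 = v ∧ x.tree ∈ agreeOn T (A.erase v)}) := by
          rw [hset, hset', hI.measure_inter_preimage_eq_mul _ _ (.of_discrete) (.of_discrete),
            offspringLaw_apply]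
      _ = offspringLaw P hX (T.deg v) *
            P (X ⁻¹' {x | x.root.1 = [] ∧ x.tree ∈ agreeOn T (A.erase v)}) := by
          rw [hU.measure_root_eq hX fun T' hT' => ⟨hmem T' hT', T'.top_mem⟩]
      _ = _ := by
          rw [ih (A.erase v) ((A.erase_subset v).trans hAT) hA'
            (by rw [Finset.card_erase_of_mem hv, hn]; rfl), ← Finset.mul_prod_erase A _ hv]
          ring

/-- Move the root to the top and take for `A` the whole vertex set, on which agreement pins down the
tree. -/
theorem measure_singleton_eq_prod (hX : Measurable X) (hU : IsUnimodular P X)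
    (hI : IndepFun (fun ω => (X ω).numChildren) (fun ω => (X ω).nonDescendantTree) P)
    (x : RootedFamilyTree) :
    P (X ⁻¹' {x}) = (1 - mean (offspringLaw P hX)) *
      ∏ v ∈ x.tree.verts, offspringLaw P hX (x.tree.deg v) := by
  rw [← measure_agreeOn hX hU hI x.tree x.tree.verts subset_rfl x.tree.parent_mem, agreeOn_verts,
    ← hU.measure_root_eq hX (u := x.root.1)]
  · congr 1
    ext ω
    constructor
    · intro h
      rw [Set.mem_preimage, Set.mem_singleton_iff] at h
      subst h
      exact ⟨rfl, rfl⟩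
    · rintro ⟨h1, h2⟩
      refine RootedFamilyTree.ext_of_verts h1 fun v => ?_
      rw [Set.mem_singleton_iff.1 h2]
  · intro T hT
    rw [Set.mem_singleton_iff.1 hT]
    exact ⟨x.root.2, x.tree.top_mem⟩

end Characterization

end FamilyTrees

theorem proposition20230305162953 {Ω : Type*} [MeasurableSpace Ω] (P : Measure Ω)
    [IsProbabilityMeasure P] (X : Ω → FamilyTrees.RootedFamilyTree) (hX : Measurable X) :
    FamilyTrees.IsTGWT P X ↔
      FamilyTrees.IsUnimodular P X ∧
        IndepFun (fun ω => (X ω).numChildren) (fun ω => (X ω).nonDescendantTree) P := by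
  constructor
  · rintro ⟨π, hπ, h⟩
    have hp := (FamilyTrees.map_code_eq_TGWT_iff hX hπ).1 h
    exact ⟨FamilyTrees.isUnimodular_of_forall_root hX fun T u v => by rw [hp, hp],
      FamilyTrees.indepFun_of_prod_verts hX _ _ hp⟩
  · rintro ⟨hU, hI⟩
    exact ⟨FamilyTrees.offspringLaw P hX, FamilyTrees.mean_offspringLaw_lt_one hX hU,
      (FamilyTrees.map_code_eq_TGWT_iff hX _).2
        (FamilyTrees.measure_singleton_eq_prod hX hU hI)⟩
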